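/- For a positive integer $n$, let $n$ items with absolute ranks $1,\dots,n$ (rank $1$ is the best) arrive at independent times, each uniformly distributed on $[0,1]$. A player who does not know $n$ observes the arrivals in chronological order: the $k$th arrival time $t_k$ together with the relative rank $r_k\in\{1,\dots,k\}$ of the $k$th arrival among the first $k$ arrivals; the $k$th arrival is a record if $r_k=1$. A (pure) strategy $\tau$ is a measurable rule which, for every $n$ and all data $(t_1,r_1),\dots,(t_n,r_n)$, chooses at most one arrival, such that only records are chosen and such that, if the $k$th arrival is chosen, then it is also chosen for every other number $n'\ge k$ of items and all data with the same first $k$ entries $(t_1,r_1),\dots,(t_k,r_k)$. Let $W(\tau,n)$ be the probability that $\tau$ chooses the best of the $n$ items. For a set $Z$ of positive integers, $\tau'$ dominates $\tau$ on $Z$ if $W(\tau',n)\ge W(\tau,n)$ for all $n\in Z$, with strict inequality for at least one $n\in Z$; $\tau'$ dominates $\tau$ if it does so on $\{1,2,\dots\}$; $\tau$ is undominated if no strategy dominates it. For $0\le x\le 1$ let $\tau_x$ be the strategy that chooses the first record arriving at or after time $x$ (if any), and let $p_n(x)=W(\tau_x,n)$. Then: (i) $\tau_x$ dominates $\tau_y$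 whenever $1/e\le x<y\le 1$; (ii) for every $n\ge 1$ the function $p_n$ has a unique maximum point $x_n$ on $[0,1]$, and $\tau_x$ is dominated by $\tau_y$ on $\{n,n+1,\dots\}$ whenever $0\le x<y\le x_n$; (iii) $\tau_x$ is undominated for $0\le x<1/e$. -/

import Mathlib

namespace BestChoice

/-- A (pure, nonrandomised) stopping strategy of a player who does not know the number `n` of items.
The observed data for `n` items are the chronologically ordered arrival times `t` and the relative
ranks `r`: the arrival with (zero-based) position `k` takes place at time `t k`, and its rank among
the first `k + 1` arrivals is `r k`, with `1` the best. `choose n t r = some k` means that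
the player stops at the arrival with position `k`, and `none` that she never stops. -/
structure Strategy where
  choose : (n : ℕ) → (Fin n → ℝ) → (Fin n → ℕ) → Option (Fin n)
  /-- The decision to stop at an arrival depends neither on the number of later arrivals nor on
  their times and ranks. -/
  nonanticipating : ∀ (n n' : ℕ) (t : Fin n → ℝ) (r : Fin n → ℕ) (t' : Fin n' → ℝ) (r' : Fin n' → ℕ)
    (k : Fin n) (k' : Fin n'), (k : ℕ) = (k' : ℕ) →
    (∀ (i : Fin n) (i' : Fin n'), (i : ℕ) = (i' : ℕ) → i ≤ k → t i = t' i' ∧ r i = r' i') →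
    choose n t r = some k → choose n' t' r' = some k'
  /-- Only records are chosen. -/
  record : ∀ (n : ℕ) (t : Fin n → ℝ) (r : Fin n → ℕ) (k : Fin n), choose n t r = some k → r k = 1
  measurable : ∀ (n : ℕ) (r : Fin n → ℕ) (k : Fin n), MeasurableSet {t | choose n t r = some k}

/-- The law of the arrival times of `n` items: independent, uniform on `[0, 1]`. The coordinate
`ω i` is the arrival time of the item with absolute rank `i + 1`, so item `0` is the best. -/
noncomputable def arrivalLaw (n : ℕ) : MeasureTheory.Measure (Fin n → ℝ) :=
  MeasureTheory.Measure.pi fun _ => MeasureTheory.volume.restrict (Set.Icc (0 : ℝ) 1)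

/-- The item that arrives at position `k` of the chronological order
(arrival times are almost surely distinct). -/
noncomputable def itemAt {n : ℕ} (ω : Fin n → ℝ) (k : Fin n) : Fin n :=
  Tuple.sort ω k

/-- The arrival times in chronological order. -/
noncomputable def arrivalTime {n : ℕ} (ω : Fin n → ℝ) (k : Fin n) : ℝ :=
  ω (itemAt ω k)

/-- The relative rank of the arrival at position `k`: its rank, with `1` the best, among the arrivals
at positions up to `k`. -/
noncomputable def relRank {n : ℕ} (ω : Fin n → ℝ) (k : Fin n) : ℕ :=
  (Finset.univ.filter fun j : Fin n => j ≤ k ∧ itemAt ω j ≤ itemAt ω k).card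

/-- The event that the strategy stops at the best of the `n` items. -/
def winEvent (τ : Strategy) (n : ℕ) : Set (Fin n → ℝ) :=
  {ω | ∃ k : Fin n, τ.choose n (arrivalTime ω) (relRank ω) = some k ∧ (itemAt ω k : ℕ) = 0}

/-- The winning probability when there are `n` items. -/
noncomputable def W (τ : Strategy) (n : ℕ) : ℝ :=
  (arrivalLaw n).real (winEvent τ n)

/-- `τ'` dominates `τ` on the set `Z` of sample sizes. -/
def DominatesOn (Z : Set ℕ) (τ' τ : Strategy) : Prop :=
  (∀ n ∈ Z, W τ n ≤ W τ' n) ∧ ∃ n ∈ Z, W τ n < W τ' n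

/-- `τ'` dominates `τ` (on all positive sample sizes). -/
def Dominates (τ' τ : Strategy) : Prop :=
  DominatesOn {n | 1 ≤ n} τ' τ

/-- No strategy dominates `τ`. -/
def Undominated (τ : Strategy) : Prop :=
  ¬ ∃ τ' : Strategy, Dominates τ' τ

open Classical in
/-- The position of the first arrival that is a record and takes place at or after time `x`. -/
noncomputable def firstRecordFrom (x : ℝ) (n : ℕ) (t : Fin n → ℝ) (r : Fin n → ℕ) :
    Option (Fin n) :=
  Fin.find? fun k => decide (x ≤ t k ∧ r k = 1)

theorem firstRecordFrom_eq_some_iff {x : ℝ} {n : ℕ} {t : Fin n → ℝ} {r : Fin n → ℕ} {k : Fin n} :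
    firstRecordFrom x n t r = some k ↔
      (x ≤ t k ∧ r k = 1) ∧ ∀ j < k, ¬ (x ≤ t j ∧ r j = 1) := by
  unfold firstRecordFrom
  rw [Fin.find?_eq_some_iff]
  simp only [decide_eq_true_eq, decide_eq_false_iff_not]

/-- The `x`-strategy: stop at the first record that arrives at or after time `x`. -/
noncomputable def xStrategy (x : ℝ) : Strategy where
  choose := firstRecordFrom x
  nonanticipating := by
    intro n n' t r t' r' k k' hk h hc
    rw [firstRecordFrom_eq_some_iff] at hc ⊢
    obtain ⟨hc, hlt⟩ := hc
    obtain ⟨ht, hr⟩ := h k k' hk le_rfl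
    refine ⟨by rwa [← ht, ← hr], fun j hj => ?_⟩
    have hjk : (j : ℕ) < k := by rw [hk]; exact hj
    have hjn : (j : ℕ) < n := hjk.trans k.isLt
    obtain ⟨ht', hr'⟩ := h ⟨j, hjn⟩ j rfl (Fin.le_def.2 hjk.le)
    rw [← ht', ← hr']
    exact hlt ⟨j, hjn⟩ (Fin.lt_def.2 hjk)
  record := fun _ _ _ _ h => (firstRecordFrom_eq_some_iff.1 h).1.2
  measurable := by
    intro n r k
    simp only [firstRecordFrom_eq_some_iff]
    have h : ∀ j : Fin n, MeasurableSet {t : Fin n → ℝ | x ≤ t j ∧ r j = 1} := fun j =>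
      (measurableSet_le measurable_const (measurable_pi_apply j)).inter (MeasurableSet.const _)
    have h' : MeasurableSet (⋂ j : Fin n, ⋂ _ : j < k, {t : Fin n → ℝ | x ≤ t j ∧ r j = 1}ᶜ) :=
      MeasurableSet.iInter fun j => MeasurableSet.iInter fun _ => (h j).compl
    convert (h k).inter h' using 1
    ext t
    simp only [Set.mem_ofPred_eq, Set.mem_inter_iff, Set.mem_iInter, Set.mem_compl_iff]

end BestChoice

/-! Conditioning on the arrival time of the best item makes the winning probability of `xStrategy x`
a polynomial in `x` (`W_xStrategy`), with derivative `-1 + ∑_{j<m} (1-x)^(j+1)/(j+1)` for `m + 1`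
items. The sum increases with `m` and stays below `-log x`. So every `p_n` strictly decreases on
`[1/e, 1]`, which is (i), and increase of `p_n` on `[0, x_n]` is inherited by all larger numbers of
items, which is (ii).

For (iii), `xStrategy x` is optimal against the weights `q ^ n`, where `q (1 - x) = 1 - 1/e`. All
these weights are positive, so a dominating strategy would have a strictly larger weighted sum of
winning probabilities. Under these weights a record at time `u` is the best of all with probability
`s = 1 - q (1 - u)`, whatever the number of earlier arrivals. The optimal continuation value is
therefore a function `G` of `s` alone, with `s G' = G - max s G` and `G 1 = 0`: `-s log s` for `s ≥
1/e` and `1/e` below (`contValue`). Integrated over histories, `G` yields a supermartingale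
inequality for every strategy (`stopSum_add_goOnSum_le`); it telescopes to `tsum_pow_mul_W_le`,
whose bound `xStrategy x` attains by `hasSum_winPoly`. -/

namespace BestChoice

open Finset MeasureTheory
open scoped ENNReal

/-! ### The polynomials `p_n`, their monotonicity and generating function -/

/-- The winning probability of the `x`-strategy with `m + 1` items, as a polynomial. -/
noncomputable def winPoly (m : ℕ) (x : ℝ) : ℝ :=
  (1 - x) ^ (m + 1) / (m + 1) + x * ∑ j ∈ range m, (1 - x) ^ (j + 1) / (j + 1)

/-- The derivative of `winPoly m`. -/
noncomputable def winPolyDeriv (m : ℕ) (x : ℝ) : ℝ :=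
  -1 + ∑ j ∈ range m, (1 - x) ^ (j + 1) / (j + 1)

theorem hasDerivAt_one_sub_pow_div (k : ℕ) (x : ℝ) :
    HasDerivAt (fun x : ℝ => (1 - x) ^ (k + 1) / (k + 1)) (-(1 - x) ^ k) x := by
  have h := (((hasDerivAt_id x).const_sub 1).pow (k + 1)).div_const ((k : ℝ) + 1)
  have hk : (k : ℝ) + 1 ≠ 0 := by positivity
  refine h.congr_deriv ?_
  simp
  field_simp

theorem hasDerivAt_winPoly (m : ℕ) (x : ℝ) :
    HasDerivAt (winPoly m) (winPolyDeriv m x) x := by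
  have hs : HasDerivAt (fun x : ℝ => ∑ j ∈ range m, (1 - x) ^ (j + 1) / (j + 1))
      (∑ j ∈ range m, -(1 - x) ^ j) x :=
    HasDerivAt.fun_sum fun j _ => hasDerivAt_one_sub_pow_div j x
  have h := (hasDerivAt_one_sub_pow_div m x).add ((hasDerivAt_id x).mul hs)
  -- `x ∑ (1-x)^j = 1 - (1-x)^m` cancels the derivative of the first term up to `-1`.
  have hg := geom_sum_mul (1 - x) m
  refine h.congr_deriv ?_
  simp only [winPolyDeriv, sum_neg_distrib, id]
  linarith

theorem winPolyDeriv_mono {m m' : ℕ} (h : m ≤ m') {x : ℝ} (hx : x ≤ 1) :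
    winPolyDeriv m x ≤ winPolyDeriv m' x := by
  unfold winPolyDeriv
  have : 0 ≤ 1 - x := by linarith
  gcongr

theorem winPolyDeriv_strictAnti {m : ℕ} (hm : 1 ≤ m) {x y : ℝ} (hxy : x < y) (hy : y ≤ 1) :
    winPolyDeriv m y < winPolyDeriv m x := by
  unfold winPolyDeriv
  have : 0 ≤ 1 - y := by linarith
  gcongr ?_ + ?_
  apply sum_lt_sum_of_nonempty (by simpa using (by omega : m ≠ 0))
  intro j _
  gcongr

/-- The sum is a partial sum of the series of `-log x`, which is below `1` for `x > 1/e`. -/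
theorem winPolyDeriv_neg {x : ℝ} (hx : Real.exp (-1) < x) (hx1 : x ≤ 1) (m : ℕ) :
    winPolyDeriv m x < 0 := by
  have h0 : 0 < x := (Real.exp_pos _).trans hx
  have h : HasSum (fun j : ℕ => (1 - x) ^ (j + 1) / ((j : ℝ) + 1)) (-Real.log x) := by
    have := Real.hasSum_pow_div_log_of_abs_lt_one (x := 1 - x) (by rw [abs_lt]; constructor <;> linarith)
    simpa using this
  have h1 := sum_le_hasSum (range m) (fun j _ => by
    have : 0 ≤ 1 - x := by linarith
    positivity) h
  have h2 := (Real.lt_log_iff_exp_lt h0).2 hx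
  unfold winPolyDeriv
  linarith

theorem exists_winPolyDeriv_sign (m : ℕ) : ∃ c ∈ Set.Icc (0 : ℝ) 1,
    (∀ x ∈ Set.Ico 0 c, 0 < winPolyDeriv m x) ∧ ∀ x ∈ Set.Ioc c 1, winPolyDeriv m x < 0 := by
  rcases Nat.eq_zero_or_pos m with rfl | hm
  · exact ⟨0, by simp, by simp, by simp [winPolyDeriv]⟩
  have hc : ContinuousOn (winPolyDeriv m) (Set.Icc 0 1) := by
    unfold winPolyDeriv
    fun_prop
  have h0 : 0 ≤ winPolyDeriv m 0 := by
    -- The derivative for `m = 1` vanishes at `0`.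
    refine le_trans ?_ (winPolyDeriv_mono hm zero_le_one)
    simp [winPolyDeriv]
  have h1 : winPolyDeriv m 1 ≤ 0 := by simp [winPolyDeriv]
  obtain ⟨c, hc, hc0⟩ := intermediate_value_Icc' zero_le_one hc ⟨h1, h0⟩
  refine ⟨c, hc, fun x hx => ?_, fun x hx => ?_⟩
  · exact hc0 ▸ winPolyDeriv_strictAnti hm hx.2 hc.2
  · exact hc0 ▸ winPolyDeriv_strictAnti hm hx.1 hx.2

theorem continuous_winPoly (m : ℕ) : Continuous (winPoly m) :=
  continuous_iff_continuousAt.2 fun x => (hasDerivAt_winPoly m x).continuousAt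

theorem winPoly_strictAntiOn {m : ℕ} {c : ℝ} (h : ∀ x ∈ Set.Ioc c 1, winPolyDeriv m x < 0) :
    StrictAntiOn (winPoly m) (Set.Icc c 1) := by
  refine strictAntiOn_of_deriv_neg (convex_Icc _ _) (continuous_winPoly m).continuousOn fun x hx => ?_
  rw [interior_Icc] at hx
  rw [(hasDerivAt_winPoly m x).deriv]
  exact h x ⟨hx.1, hx.2.le⟩

theorem winPoly_strictMonoOn {m : ℕ} {c : ℝ} (h : ∀ x ∈ Set.Ico 0 c, 0 < winPolyDeriv m x) :
    StrictMonoOn (winPoly m) (Set.Icc 0 c) := by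
  refine strictMonoOn_of_deriv_pos (convex_Icc _ _) (continuous_winPoly m).continuousOn fun x hx => ?_
  rw [interior_Icc] at hx
  rw [(hasDerivAt_winPoly m x).deriv]
  exact h x ⟨hx.1.le, hx.2⟩

/-- The generating function of the winning probabilities of the `x`-strategy. -/
theorem hasSum_winPoly {x q : ℝ} (hx0 : 0 ≤ x) (hx1 : x ≤ 1) (hq0 : 0 < q) (hq1 : q < 1) :
    HasSum (fun m => q ^ (m + 1) * winPoly m x)
      (-Real.log (1 - q * (1 - x)) * (1 + x * (q / (1 - q)))) := by
  set z := q * (1 - x)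
  have hz0 : 0 ≤ z := mul_nonneg hq0.le (by linarith)
  have hz1 : z < 1 := by nlinarith
  have hlog : HasSum (fun j : ℕ => z ^ (j + 1) / ((j : ℝ) + 1)) (-Real.log (1 - z)) :=
    Real.hasSum_pow_div_log_of_abs_lt_one (by rwa [abs_of_nonneg hz0])
  have hgeo : HasSum (fun l : ℕ => q ^ (l + 1)) (q / (1 - q)) := by
    have := (hasSum_geometric_of_lt_one hq0.le hq1).mul_left q
    simpa only [pow_succ', div_eq_mul_inv] using this
  have hprod := hasSum_sum_range_mul_of_summable_norm hlog.summable.norm hgeo.summable.norm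
  rw [hlog.tsum_eq, hgeo.tsum_eq] at hprod
  have hshift : HasSum (fun m : ℕ => q ^ (m + 1) * ∑ j ∈ range m, (1 - x) ^ (j + 1) / ((j : ℝ) + 1))
      (-Real.log (1 - z) * (q / (1 - q))) := by
    -- The term `m = 0` is empty; from `m = 1` on, the terms are the Cauchy product of the
    -- logarithmic and the geometric series.
    rw [← hasSum_nat_add_iff' 1]
    simp only [range_one, sum_singleton, range_zero, sum_empty, mul_zero, sub_zero]
    refine hprod.congr_fun ?_ 
    intro m
    rw [mul_sum]
    refine sum_congr rfl fun j hj => ?_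
    have hj : j ≤ m := by simpa [Nat.lt_succ_iff] using hj
    have : m + 1 + 1 = (j + 1) + (m - j + 1) := by omega
    rw [this, pow_add, mul_pow]
    ring
  have := hlog.add (hshift.mul_left x)
  convert this using 1
  · funext m
    simp only [winPoly, z, mul_pow]
    ring
  · ring

/-! ### The winning event of an `x`-strategy -/

/-- The relative ranks when the item with label `σ k` arrives at position `k`. -/
def permRank {n : ℕ} (σ : Equiv.Perm (Fin n)) (k : Fin n) : ℕ :=
  (univ.filter fun j : Fin n => j ≤ k ∧ σ j ≤ σ k).card

theorem relRank_eq_permRank {n : ℕ} (ω : Fin n → ℝ) : relRank ω = permRank (Tuple.sort ω) := rfl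

theorem permRank_eq_one_iff {n : ℕ} {σ : Equiv.Perm (Fin n)} {k : Fin n} :
    permRank σ k = 1 ↔ ∀ j < k, σ k < σ j := by
  unfold permRank
  rw [card_eq_one]
  constructor
  · rintro ⟨a, ha⟩ j hj
    have hk : k ∈ univ.filter fun j : Fin n => j ≤ k ∧ σ j ≤ σ k := by simp
    rw [ha, mem_singleton] at hk
    subst hk
    by_contra hlt
    have : j ∈ univ.filter fun j : Fin n => j ≤ k ∧ σ j ≤ σ k := by
      simpa using ⟨hj.le, not_lt.1 hlt⟩
    rw [ha, mem_singleton] at this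
    exact hj.ne this
  · intro h
    refine ⟨k, ?_⟩
    ext j
    simp only [mem_filter, mem_univ, true_and, mem_singleton]
    refine ⟨fun hj => ?_, fun hj => by simp [hj]⟩
    rcases hj.1.lt_or_eq with hlt | rfl
    · exact absurd hj.2 (not_le.2 (h j hlt))
    · rfl

/-- The best item arrives at or after time `x`, and the best of the items that precede it (if any)
arrives before time `x`. -/
def xWin (m : ℕ) (x : ℝ) : Set (Fin (m + 1) → ℝ) :=
  {ω | x ≤ ω 0 ∧ ∀ i, ω i < ω 0 → (∀ j < i, ω 0 ≤ ω j) → ω i < x}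

/-- The best item is always a record, so it is chosen iff it arrives from `x` on and no earlier
record does. The best of its predecessors is their last record, so only that one has to be tested.
-/
theorem mem_winEvent_xStrategy_iff {m : ℕ} {x : ℝ} {ω : Fin (m + 1) → ℝ}
    (hω : Function.Injective ω) :
    ω ∈ winEvent (xStrategy x) (m + 1) ↔ ω ∈ xWin m x := by
  have hmono : StrictMono (ω ∘ Tuple.sort ω) :=
    (Tuple.monotone_sort ω).strictMono_of_injective (hω.comp (Tuple.sort ω).injective)
  set σ := Tuple.sort ω with hσ
  have hlt : ∀ i j, ω i < ω j ↔ σ.symm i < σ.symm j := fun i j => by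
    simpa using (hmono.lt_iff_lt (a := σ.symm i) (b := σ.symm j))
  have hwin : ω ∈ winEvent (xStrategy x) (m + 1) ↔
      x ≤ ω 0 ∧ ∀ i, ω i < ω 0 → x ≤ ω i → ∃ i' < i, ω i' < ω i := by
    have h0 : ∀ k, ((itemAt ω k : Fin (m + 1)) : ℕ) = 0 ↔ k = σ.symm 0 := fun k => by
      rw [Equiv.eq_symm_apply, Fin.ext_iff]
      rfl
    have hrec : ∀ i, permRank σ (σ.symm i) = 1 ↔ ¬ ∃ i' < i, ω i' < ω i := fun i => by
      rw [permRank_eq_one_iff, ← not_iff_not, not_not]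
      push Not
      constructor
      · rintro ⟨j, hj, h⟩
        refine ⟨σ j, lt_of_le_of_ne (by simpa using h) fun h => ?_, (hlt _ _).2 (by simpa using hj)⟩
        rw [← h] at hj
        simp at hj
      · rintro ⟨i', hi', h⟩
        exact ⟨σ.symm i', (hlt _ _).1 h, by simpa using hi'.le⟩
    simp only [winEvent, Set.mem_ofPred_eq, h0, exists_eq_right, relRank_eq_permRank, ← hσ]
    change firstRecordFrom x (m + 1) (arrivalTime ω) (permRank σ) = some (σ.symm 0) ↔ _
    rw [firstRecordFrom_eq_some_iff]
    have hone : permRank σ (σ.symm 0) = 1 := by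
      rw [hrec]
      rintro ⟨i, hi, -⟩
      exact absurd hi (Fin.not_lt_zero i)
    have htime : ∀ i, arrivalTime ω (σ.symm i) = ω i := fun i => by
      simp [arrivalTime, itemAt, ← hσ]
    simp only [hone, htime, and_true]
    refine and_congr_right fun _ => ⟨fun h i hi hx => ?_, fun h j hj hx => ?_⟩
    · by_contra hr
      exact h _ ((hlt _ _).1 hi) ⟨by rwa [htime], (hrec i).2 hr⟩
    · obtain ⟨i, rfl⟩ := σ.symm.surjective j
      rw [htime, hrec] at hx
      exact hx.2 (h i ((hlt _ _).2 hj) hx.1)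
  rw [hwin]
  refine and_congr_right fun _ => ⟨fun h i hi hfirst => ?_, fun h i hi hx => ?_⟩
  · by_contra hx
    obtain ⟨i', hi', hlt'⟩ := h i hi (not_lt.1 hx)
    exact absurd (hlt'.trans hi) (not_lt.2 (hfirst i' hi'))
  -- `i'` is the least label, hence the best item, among the predecessors of the best item.
  · obtain ⟨i', hi', hmin⟩ : ∃ i', ω i' < ω 0 ∧ ∀ j < i', ω 0 ≤ ω j := by
      have hne : (univ.filter fun i => ω i < ω 0).Nonempty := ⟨i, by simpa using hi⟩
      refine ⟨_, by simpa using min'_mem _ hne, fun j hj => ?_⟩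
      by_contra hlt'
      exact absurd (min'_le _ j (by simpa using hlt')) (not_le.2 hj)
    have hx' := (h i' hi' hmin).trans_le hx
    refine ⟨i', ?_, hx'⟩
    rcases lt_trichotomy i' i with h1 | h1 | h1
    · exact h1
    · exact absurd hx' (by simp [h1])
    · exact absurd hi (not_lt.2 (hmin i h1))

/-! ### The law of the arrival times and the computation of `p_n` -/

theorem arrivalLaw_eq_restrict (n : ℕ) :
    arrivalLaw n = (volume : Measure (Fin n → ℝ)).restrict
      (Set.univ.pi fun _ => Set.Icc (0 : ℝ) 1) := by
  rw [volume_pi, Measure.restrict_pi_pi]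
  rfl

instance (n : ℕ) : IsProbabilityMeasure (arrivalLaw n) := by
  have : IsProbabilityMeasure ((volume : Measure ℝ).restrict (Set.Icc (0 : ℝ) 1)) :=
    ⟨by simp⟩
  unfold arrivalLaw
  infer_instance

theorem ae_injective_arrivalLaw (n : ℕ) : ∀ᵐ ω ∂arrivalLaw n, Function.Injective ω := by
  have h : ∀ i j : Fin n, i ≠ j → ∀ᵐ ω ∂arrivalLaw n, ω i ≠ ω j := by
    intro i j hij
    rw [arrivalLaw_eq_restrict]
    refine ae_restrict_of_ae ?_
    let p : Submodule ℝ (Fin n → ℝ) :=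
      LinearMap.ker (LinearMap.proj (R := ℝ) (φ := fun _ : Fin n => ℝ) i - LinearMap.proj j)
    have hp : p ≠ ⊤ := by
      intro htop
      have : (Pi.single i 1 : Fin n → ℝ) ∈ p := by rw [htop]; trivial
      simp [p, LinearMap.mem_ker, hij.symm] at this
    have := Measure.addHaar_submodule (volume : Measure (Fin n → ℝ)) p hp
    rw [ae_iff]
    convert this using 2
    ext ω
    simp [p, LinearMap.mem_ker, sub_eq_zero]
  have h' : ∀ᵐ ω ∂arrivalLaw n, ∀ i j : Fin n, i ≠ j → ω i ≠ ω j := by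
    rw [ae_all_iff]; intro i
    rw [ae_all_iff]; intro j
    by_cases hij : i = j
    · simp [hij]
    · filter_upwards [h i j hij] with ω hω _ using hω
  filter_upwards [h'] with ω hω i j hij
  by_contra hne
  exact hω i j hne hij

theorem arrivalLaw_succ_apply {m : ℕ} {A : Set (Fin (m + 1) → ℝ)} (hA : MeasurableSet A) :
    arrivalLaw (m + 1) A =
      ∫⁻ a in Set.Icc (0 : ℝ) 1, arrivalLaw m {ω | (Fin.cons a ω : Fin (m + 1) → ℝ) ∈ A} := by
  have hmp := (measurePreserving_piFinSuccAbove
    (fun _ : Fin (m + 1) => (volume : Measure ℝ).restrict (Set.Icc (0 : ℝ) 1)) 0).symm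
  have := hmp.measure_preimage hA.nullMeasurableSet
  rw [Measure.prod_apply (hmp.measurable hA)] at this
  unfold arrivalLaw
  rw [← this]
  refine lintegral_congr fun a => ?_
  congr 1
  ext ω
  change (Fin.insertNth 0 a ω : Fin (m + 1) → ℝ) ∈ A ↔ _
  rw [Fin.insertNth_zero']
  rfl

/-- Of `m` items, the best one of those arriving before time `u` (if any) arrives before `x`. -/
def bestBefore (m : ℕ) (u x : ℝ) : Set (Fin m → ℝ) :=
  {ω | ∀ i, ω i < u → (∀ j < i, u ≤ ω j) → ω i < x}

theorem measurableSet_bestBefore (m : ℕ) (u x : ℝ) : MeasurableSet (bestBefore m u x) := by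
  unfold bestBefore
  measurability

theorem measurableSet_xWin (m : ℕ) (x : ℝ) : MeasurableSet (xWin m x) := by
  unfold xWin
  measurability

theorem cons_mem_bestBefore {m : ℕ} {u x a : ℝ} (hxu : x ≤ u) {ω : Fin m → ℝ} :
    (Fin.cons a ω : Fin (m + 1) → ℝ) ∈ bestBefore (m + 1) u x ↔
      a < x ∨ u ≤ a ∧ ω ∈ bestBefore m u x := by
  simp only [bestBefore, Set.mem_ofPred_eq, Fin.forall_fin_succ (n := m), Fin.cons_zero,
    Fin.cons_succ, Fin.not_lt_zero, Fin.succ_pos, Fin.succ_lt_succ_iff, IsEmpty.forall_iff,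
    forall_true_left, implies_true]
  rcases lt_or_ge a u with h | h
  · simp [h, not_le.2 h]
  · simp [h, not_lt.2 h, not_lt.2 (hxu.trans h)]

theorem cons_mem_xWin {m : ℕ} {x a : ℝ} {ω : Fin m → ℝ} :
    (Fin.cons a ω : Fin (m + 1) → ℝ) ∈ xWin m x ↔ x ≤ a ∧ ω ∈ bestBefore m a x := by
  simp [xWin, bestBefore, Fin.forall_fin_succ]

/-- Look at the best of the items: arriving before `x` settles the event, arriving in `[x, u)`
refutes it, and arriving from `u` on leaves the same question for one item fewer. Hence `P (m+1) = x
+ (1-u) P m`. -/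
theorem arrivalLaw_bestBefore (m : ℕ) {u x : ℝ} (hx : 0 ≤ x) (hxu : x ≤ u) (hu : u ≤ 1) :
    arrivalLaw m (bestBefore m u x) =
      ENNReal.ofReal ((1 - u) ^ m + x * ∑ j ∈ range m, (1 - u) ^ j) := by
  induction m with
  | zero =>
    have : bestBefore 0 u x = Set.univ := by ext; simp [bestBefore]
    simp [this]
  | succ m ih =>
    have hu' : 0 ≤ 1 - u := by linarith
    rw [arrivalLaw_succ_apply (measurableSet_bestBefore _ _ _)]
    have hint : ∀ a : ℝ, arrivalLaw m {ω | (Fin.cons a ω : Fin (m + 1) → ℝ) ∈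
        bestBefore (m + 1) u x} = (Set.Iio x).indicator (fun _ => 1) a +
        (Set.Ici u).indicator (fun _ => arrivalLaw m (bestBefore m u x)) a := by
      intro a
      simp only [cons_mem_bestBefore hxu]
      rcases lt_or_ge a x with h | h
      · simp [h, not_le.2 (h.trans_le hxu)]
      · by_cases h' : u ≤ a
        · simp [not_lt.2 h, h']
        · simp [not_lt.2 h, h']
    simp only [hint]
    rw [lintegral_add_left (measurable_const.indicator measurableSet_Iio),
      lintegral_indicator_const measurableSet_Iio, lintegral_indicator_const measurableSet_Ici,
      Measure.restrict_apply measurableSet_Iio, Measure.restrict_apply measurableSet_Ici,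
      show Set.Iio x ∩ Set.Icc 0 1 = Set.Ico 0 x by
        ext; simp only [Set.mem_inter_iff, Set.mem_Iio, Set.mem_Icc, Set.mem_Ico]; grind,
      show Set.Ici u ∩ Set.Icc 0 1 = Set.Icc u 1 by
        ext; simp only [Set.mem_inter_iff, Set.mem_Ici, Set.mem_Icc]; grind,
      Real.volume_Ico, Real.volume_Icc, ih, one_mul, ← ENNReal.ofReal_mul (by positivity),
      ← ENNReal.ofReal_add (by linarith) (by positivity), sum_range_succ' _ m]
    congr 1
    simp only [pow_succ, ← sum_mul]
    ring

theorem lintegral_Icc_of_hasDerivAt {F f : ℝ → ℝ} {a b : ℝ} {s : Set ℝ} (hs : s.Countable)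
    (hab : a ≤ b) (hF : ContinuousOn F (Set.Icc a b)) (hf : ContinuousOn f (Set.Icc a b))
    (hderiv : ∀ u ∈ Set.Ioo a b \ s, HasDerivAt F (f u) u) (hnn : ∀ u ∈ Set.Icc a b, 0 ≤ f u) :
    ∫⁻ u in Set.Icc a b, ENNReal.ofReal (f u) = ENNReal.ofReal (F b - F a) := by
  have hint : IntervalIntegrable f volume a b :=
    (hf.mono (by rw [Set.uIcc_of_le hab])).intervalIntegrable
  rw [← ofReal_integral_eq_lintegral_ofReal hf.integrableOn_Icc
    ((ae_restrict_iff' measurableSet_Icc).2 (Filter.Eventually.of_forall hnn)),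
    integral_Icc_eq_integral_Ioc, ← intervalIntegral.integral_of_le hab,
    integral_eq_of_hasDerivAt_off_countable_of_le F f hab hs hF hderiv hint]

theorem W_xStrategy (m : ℕ) {x : ℝ} (hx0 : 0 ≤ x) (hx1 : x ≤ 1) :
    W (xStrategy x) (m + 1) = winPoly m x := by
  have hcongr : winEvent (xStrategy x) (m + 1) =ᵐ[arrivalLaw (m + 1)] xWin m x := by
    filter_upwards [ae_injective_arrivalLaw (m + 1)] with ω hω
    exact propext (mem_winEvent_xStrategy_iff hω)
  have h1x : 0 ≤ 1 - x := by linarith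
  rw [W, measureReal_congr hcongr, measureReal_def, arrivalLaw_succ_apply (measurableSet_xWin m x)]
  have hint : ∀ a ∈ Set.Icc (0 : ℝ) 1,
      arrivalLaw m {ω | (Fin.cons a ω : Fin (m + 1) → ℝ) ∈ xWin m x} = (Set.Ici x).indicator
        (fun a => ENNReal.ofReal ((1 - a) ^ m + x * ∑ j ∈ range m, (1 - a) ^ j)) a := by
    intro a ha
    simp only [cons_mem_xWin]
    by_cases h : x ≤ a
    · simp [h, arrivalLaw_bestBefore m hx0 h ha.2]
    · simp [h]
  rw [setLIntegral_congr_fun measurableSet_Icc hint, lintegral_indicator measurableSet_Ici,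
    Measure.restrict_restrict measurableSet_Ici,
    show Set.Ici x ∩ Set.Icc 0 1 = Set.Icc x 1 by
      ext; simp only [Set.mem_inter_iff, Set.mem_Ici, Set.mem_Icc]; grind,
    lintegral_Icc_of_hasDerivAt (F := fun u => -((1 - u) ^ (m + 1) / (m + 1) +
      x * ∑ j ∈ range m, (1 - u) ^ (j + 1) / (j + 1))) Set.countable_empty hx1 (by fun_prop)
      (by fun_prop) ?_ ?_, ENNReal.toReal_ofReal]
  · simp [winPoly]
  · simp only [sub_self, ne_eq, Nat.add_eq_zero_iff, one_ne_zero, and_false, not_false_eq_true,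
      zero_pow, zero_div, sum_const_zero, mul_zero, add_zero, neg_zero, sub_neg_eq_add, zero_add]
    positivity
  · intro u _
    have := ((hasDerivAt_one_sub_pow_div m u).add ((HasDerivAt.fun_sum (u := range m) fun j _ =>
      hasDerivAt_one_sub_pow_div j u).const_mul x)).neg
    refine this.congr_deriv ?_
    simp only [sum_neg_distrib]
    ring
  · intro u hu
    have : 0 ≤ 1 - u := by linarith [hu.2]
    positivity

/-! ### Relative ranks and integration over histories -/

theorem permRank_mem_Icc {n : ℕ} (σ : Equiv.Perm (Fin n)) (k : Fin n) :
    permRank σ k ∈ Icc 1 ((k : ℕ) + 1) := by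
  rw [mem_Icc]
  constructor
  · exact card_pos.2 ⟨k, by simp⟩
  · rw [← Fin.card_Iic]
    exact card_le_card fun j hj => by simpa using (mem_filter.1 hj).2.1

/-- The relative ranks determine the order of the items. -/
theorem permRank_injective (n : ℕ) :
    Function.Injective (permRank : Equiv.Perm (Fin n) → Fin n → ℕ) := by
  intro σ ρ h
  -- Strong induction on `j`. Before `j` both permutations order the positions alike, so `A` and `B`
  -- are, apart from `j`, initial segments of one order. They are thus nested, and equal cardinality
  -- makes them equal.
  have key : ∀ j : Fin n, ∀ i < j, (σ i ≤ σ j ↔ ρ i ≤ ρ j) := by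
    intro j
    induction j using WellFoundedLT.induction with
    | ind j ih =>
    have hord : ∀ a ≤ j, ∀ b ≤ j, a ≠ j → b ≠ j → σ a ≤ σ b → ρ a ≤ ρ b := by
      intro a ha b hb haj hbj hab
      rcases lt_trichotomy a b with hlt | rfl | hlt
      · exact (ih b (lt_of_le_of_ne hb hbj) a hlt).1 hab
      · exact le_rfl
      · by_contra hc
        have := (ih a (lt_of_le_of_ne ha haj) b hlt).2 (not_le.1 hc).le
        exact hlt.ne' (σ.injective (le_antisymm hab this))
    set A := univ.filter fun i : Fin n => i ≤ j ∧ σ i ≤ σ j with hA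
    set B := univ.filter fun i : Fin n => i ≤ j ∧ ρ i ≤ ρ j with hB
    have hcard : A.card = B.card := congr_fun h j
    have hAB : A = B := by
      by_cases hsub : A ⊆ B
      · exact eq_of_subset_of_card_le hsub hcard.ge
      · obtain ⟨a, haA, haB⟩ := not_subset.1 hsub
        refine (eq_of_subset_of_card_le (fun b hb => ?_) hcard.le).symm
        simp only [hA, hB, mem_filter, mem_univ, true_and, not_and, not_le] at haA haB hb ⊢
        refine ⟨hb.1, ?_⟩
        by_contra hlt
        have haj : a ≠ j := by rintro rfl; exact absurd (haB le_rfl) (lt_irrefl _)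
        have hbj : b ≠ j := by rintro rfl; exact hlt le_rfl
        have := hord a haA.1 b hb.1 haj hbj (haA.2.trans (not_le.1 hlt).le)
        exact absurd (this.trans hb.2) (not_le.2 (haB haA.1))
    intro i hi
    have := Finset.ext_iff.1 hAB i
    simpa [hA, hB, hi.le] using this
  have hmono : ∀ a b, σ a < σ b → ρ a < ρ b := by
    intro a b hab
    rcases lt_trichotomy a b with hlt | rfl | hlt
    · exact lt_of_le_of_ne ((key b a hlt).1 hab.le) fun h => hlt.ne (ρ.injective h)
    · exact absurd hab (lt_irrefl _)
    · exact not_le.1 fun hc => absurd ((key a b hlt).2 hc) (not_le.2 hab)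
  -- The only order automorphism of `Fin n` is the identity.
  have hs : StrictMono (ρ ∘ σ.symm) := fun a b hab => hmono _ _ (by simpa using hab)
  have : (ρ ∘ σ.symm) = id := by
    have e := Subsingleton.elim (hs.orderIsoOfSurjective _ (ρ.surjective.comp σ.symm.surjective))
      (OrderIso.refl (Fin n))
    funext a
    exact congrArg (fun f : Fin n ≃o Fin n => f a) e
  ext a
  have := congr_fun this (σ a)
  simp only [Function.comp_apply, Equiv.symm_apply_apply, id] at this
  rw [this]

/-- The chronologically ordered sequences of `k` arrival times. -/
def orderedTimes (k : ℕ) : Set (Fin k → ℝ) :=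
  {t | Monotone t ∧ ∀ i, t i ∈ Set.Icc (0 : ℝ) 1}

/-- The possible sequences of relative ranks of `k` arrivals. -/
def rankSeqs (k : ℕ) : Finset (Fin k → ℕ) :=
  Fintype.piFinset fun i => Icc 1 ((i : ℕ) + 1)

/-- The time of the last arrival, with the convention `0` if there are no arrivals. -/
def lastTime : {k : ℕ} → (Fin k → ℝ) → ℝ
  | 0, _ => 0
  | k + 1, t => t (Fin.last k)

/-- The integral of `F` over all histories of `k` arrivals. -/
noncomputable def historySum (k : ℕ) (F : (Fin k → ℝ) → (Fin k → ℕ) → ℝ≥0∞) : ℝ≥0∞ :=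
  ∑ r ∈ rankSeqs k, ∫⁻ t in orderedTimes k, F t r

theorem measurableSet_orderedTimes (k : ℕ) : MeasurableSet (orderedTimes k) := by
  unfold orderedTimes Monotone
  measurability

theorem lastTime_mem {k : ℕ} {t : Fin k → ℝ} (ht : t ∈ orderedTimes k) :
    lastTime t ∈ Set.Icc (0 : ℝ) 1 := by
  cases k with
  | zero => simp [lastTime]
  | succ k => exact ht.2 _

theorem snoc_mem_orderedTimes {k : ℕ} {t : Fin k → ℝ} {u : ℝ} :
    (Fin.snoc t u : Fin (k + 1) → ℝ) ∈ orderedTimes (k + 1) ↔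
      t ∈ orderedTimes k ∧ u ∈ Set.Icc (lastTime t) 1 := by
  constructor
  · rintro ⟨hm, hi⟩
    refine ⟨⟨fun i j hij => ?_, fun i => ?_⟩, ?_, ?_⟩
    · simpa using hm (Fin.castSucc_le_castSucc_iff.2 hij)
    · simpa using hi i.castSucc
    · cases k with
      | zero => simpa [lastTime, Fin.snoc] using (hi (Fin.last 0)).1
      | succ k => simpa [lastTime] using hm (Fin.le_last (Fin.castSucc (Fin.last k)))
    · simpa using (hi (Fin.last k)).2
  · rintro ⟨⟨hm, hi⟩, hu⟩
    have hle : ∀ i, t i ≤ u := fun i => by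
      cases k with
      | zero => exact i.elim0
      | succ k => exact (hm (Fin.le_last i)).trans hu.1
    refine ⟨fun i j hij => ?_, fun i => ?_⟩
    · induction j using Fin.lastCases with
      | last =>
        induction i using Fin.lastCases with
        | last => exact le_rfl
        | cast i => simpa using hle i
      | cast j =>
        induction i using Fin.lastCases with
        | last => exact absurd (Fin.castSucc_lt_last j) (not_lt.2 hij)
        | cast i => simpa using hm (Fin.castSucc_le_castSucc_iff.1 hij)
    · induction i using Fin.lastCases with
      | last => simpa using ⟨(lastTime_mem ⟨hm, hi⟩).1.trans hu.1, hu.2⟩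
      | cast i => simpa using hi i

theorem sum_rankSeqs_succ (k : ℕ) (G : (Fin (k + 1) → ℕ) → ℝ≥0∞) :
    ∑ r ∈ rankSeqs (k + 1), G r =
      ∑ r ∈ rankSeqs k, ∑ ρ ∈ Icc 1 (k + 1), G (Fin.snoc r ρ) := by
  rw [← sum_product']
  refine sum_bij' (fun r _ => (Fin.init r, r (Fin.last k))) (fun p _ => Fin.snoc p.1 p.2)
    ?_ ?_ ?_ ?_ ?_
  · intro r hr
    simp only [rankSeqs, Fintype.mem_piFinset, mem_product] at hr ⊢
    exact ⟨fun i => by simpa [Fin.init] using hr i.castSucc, by simpa using hr (Fin.last k)⟩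
  · rintro ⟨r, ρ⟩ hr
    simp only [rankSeqs, Fintype.mem_piFinset, mem_product] at hr ⊢
    intro i
    induction i using Fin.lastCases with
    | last => simpa using hr.2
    | cast i => simpa using hr.1 i
  · intro r _; simp
  · rintro ⟨r, ρ⟩ _; simp
  · intro r _; simp

theorem setLIntegral_orderedTimes_succ (k : ℕ) {G : (Fin (k + 1) → ℝ) → ℝ≥0∞} (hG : Measurable G) :
    ∫⁻ t in orderedTimes (k + 1), G t =
      ∫⁻ t in orderedTimes k, ∫⁻ u in Set.Icc (lastTime t) 1, G (Fin.snoc t u) := by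
  have hG' := hG.indicator (measurableSet_orderedTimes (k + 1))
  have hmp := (volume_preserving_piFinSuccAbove (fun _ : Fin (k + 1) => ℝ) (Fin.last k)).symm
  rw [← lintegral_indicator (measurableSet_orderedTimes _),
    ← lintegral_indicator (measurableSet_orderedTimes _), ← hmp.lintegral_comp hG',
    Measure.volume_eq_prod, 
    lintegral_prod_symm' (fun p => (orderedTimes (k + 1)).indicator G
      ((MeasurableEquiv.piFinSuccAbove (fun _ : Fin (k + 1) => ℝ) (Fin.last k)).symm p))
      (hG'.comp hmp.measurable)]
  refine lintegral_congr fun t => ?_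
  have hsn : ∀ u : ℝ, (MeasurableEquiv.piFinSuccAbove (fun _ : Fin (k + 1) => ℝ)
      (Fin.last k)).symm (u, t) = (Fin.snoc t u : Fin (k + 1) → ℝ) := fun u =>
    Fin.insertNth_last' u t
  simp only [hsn]
  by_cases ht : t ∈ orderedTimes k
  · rw [Set.indicator_of_mem ht, ← lintegral_indicator measurableSet_Icc]
    refine lintegral_congr fun u => ?_
    by_cases hu : u ∈ Set.Icc (lastTime t) 1
    · rw [Set.indicator_of_mem (snoc_mem_orderedTimes.2 ⟨ht, hu⟩), Set.indicator_of_mem hu]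
    · rw [Set.indicator_of_notMem (fun h => hu (snoc_mem_orderedTimes.1 h).2),
        Set.indicator_of_notMem hu]
  · rw [Set.indicator_of_notMem ht]
    refine (lintegral_congr fun u => ?_).trans lintegral_zero
    exact Set.indicator_of_notMem (fun h => ht (snoc_mem_orderedTimes.1 h).1) _

theorem historySum_mono {k : ℕ} {F G : (Fin k → ℝ) → (Fin k → ℕ) → ℝ≥0∞}
    (h : ∀ t ∈ orderedTimes k, ∀ r, F t r ≤ G t r) : historySum k F ≤ historySum k G :=
  sum_le_sum fun r _ => setLIntegral_mono' (measurableSet_orderedTimes k) fun t ht => h t ht r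

theorem historySum_add {k : ℕ} {F : (Fin k → ℝ) → (Fin k → ℕ) → ℝ≥0∞}
    (hF : ∀ r, Measurable fun t => F t r) (G : (Fin k → ℝ) → (Fin k → ℕ) → ℝ≥0∞) :
    historySum k (fun t r => F t r + G t r) = historySum k F + historySum k G := by
  simp only [historySum, ← sum_add_distrib]
  exact sum_congr rfl fun r _ => lintegral_add_left (hF r) _

/-- Integration over the last arrival of a weight that depends, given the earlier history,
only on the last arrival time and on whether the last arrival is a record. -/
theorem historySum_succ {k : ℕ} {A : (Fin k → ℕ) → Set (Fin k → ℝ)}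
    (hA : ∀ r, MeasurableSet (A r)) {c₁ c₀ : ℝ → ℝ≥0∞} (h₁ : Measurable c₁) (h₀ : Measurable c₀) :
    historySum (k + 1) (fun t r => (A (Fin.init r)).indicator
      (fun _ => if r (Fin.last k) = 1 then c₁ (t (Fin.last k)) else c₀ (t (Fin.last k)))
      (Fin.init t)) =
    historySum k (fun t r => (A r).indicator
      (fun t => ∫⁻ u in Set.Icc (lastTime t) 1, (c₁ u + k * c₀ u)) t) := by
  unfold historySum
  rw [sum_rankSeqs_succ]
  refine sum_congr rfl fun r _ => ?_
  have hm : ∀ ρ : ℕ, Measurable fun t : Fin (k + 1) → ℝ => (A r).indicator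
      (fun _ => if ρ = 1 then c₁ (t (Fin.last k)) else c₀ (t (Fin.last k))) (Fin.init t) := by
    intro ρ
    have hinit : Measurable (Fin.init : (Fin (k + 1) → ℝ) → Fin k → ℝ) :=
      measurable_pi_iff.2 fun i => measurable_pi_apply _
    have : Measurable fun t : Fin (k + 1) → ℝ =>
        if ρ = 1 then c₁ (t (Fin.last k)) else c₀ (t (Fin.last k)) := by
      split_ifs
      · exact h₁.comp (measurable_pi_apply _)
      · exact h₀.comp (measurable_pi_apply _)
    exact this.indicator (hinit (hA r))
  -- Of the `k + 1` possible relative ranks of the new arrival, exactly one makes it a record.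
  have hsum : ∀ a b : ℝ≥0∞, ∑ ρ ∈ Icc 1 (k + 1), (if ρ = 1 then a else b) = a + k * b := by
    intro a b
    rw [← add_sum_Ioc_eq_sum_Icc (by omega), if_pos rfl,
      sum_congr rfl fun ρ hρ => if_neg (by have := (mem_Ioc.1 hρ).1; omega)]
    simp
  simp only [Fin.init_snoc, Fin.snoc_last]
  rw [← lintegral_finsetSum _ fun ρ _ => hm ρ,
    setLIntegral_orderedTimes_succ k (measurable_fun_sum _ fun ρ _ => hm ρ)]
  refine lintegral_congr fun t => ?_
  simp only [Fin.init_snoc, Fin.snoc_last]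
  by_cases ht : t ∈ A r
  · simp only [Set.indicator_of_mem ht, hsum]
  · simp only [Set.indicator_of_notMem ht, sum_const_zero, lintegral_zero]

/-! ### The histories of a strategy and its winning probability -/

/-- The histories of `k` arrivals after which the strategy has not stopped. -/
def goOn (τ : Strategy) (k : ℕ) (r : Fin k → ℕ) : Set (Fin k → ℝ) :=
  {t | τ.choose k t r = none}

/-- The histories of `k + 1` arrivals at the last of which the strategy stops. -/
def stopNow (τ : Strategy) (k : ℕ) (r : Fin (k + 1) → ℕ) : Set (Fin (k + 1) → ℝ) :=
  {t | τ.choose (k + 1) t r = some (Fin.last k)}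

/-- The histories of `k` arrivals in which the strategy has stopped and no record came later. -/
def ahead (τ : Strategy) (k : ℕ) (r : Fin k → ℕ) : Set (Fin k → ℝ) :=
  {t | ∃ j, τ.choose k t r = some j ∧ ∀ l, j < l → r l ≠ 1}

theorem choose_succ_eq_castSucc_iff (τ : Strategy) {k : ℕ} (t : Fin (k + 1) → ℝ)
    (r : Fin (k + 1) → ℕ) (j : Fin k) :
    τ.choose (k + 1) t r = some j.castSucc ↔ τ.choose k (Fin.init t) (Fin.init r) = some j := by
  constructor
  · refine τ.nonanticipating _ _ _ _ _ _ _ _ rfl fun i i' hi _ => ?_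
    have : i = i'.castSucc := Fin.ext hi
    subst this
    exact ⟨rfl, rfl⟩
  · refine τ.nonanticipating _ _ _ _ _ _ _ _ rfl fun i i' hi _ => ?_
    have : i' = i.castSucc := Fin.ext hi.symm
    subst this
    exact ⟨rfl, rfl⟩

theorem init_mem_goOn_of_mem_goOn {τ : Strategy} {k : ℕ} {t : Fin (k + 1) → ℝ}
    {r : Fin (k + 1) → ℕ} (h : t ∈ goOn τ (k + 1) r) : Fin.init t ∈ goOn τ k (Fin.init r) := by
  simp only [goOn, Set.mem_ofPred_eq] at h ⊢
  rw [Option.eq_none_iff_forall_ne_some]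
  intro j hj
  rw [← choose_succ_eq_castSucc_iff, h] at hj
  simp at hj

theorem init_mem_goOn_of_mem_stopNow {τ : Strategy} {k : ℕ} {t : Fin (k + 1) → ℝ}
    {r : Fin (k + 1) → ℕ} (h : t ∈ stopNow τ k r) : Fin.init t ∈ goOn τ k (Fin.init r) := by
  simp only [goOn, stopNow, Set.mem_ofPred_eq] at h ⊢
  rw [Option.eq_none_iff_forall_ne_some]
  intro j hj
  rw [← choose_succ_eq_castSucc_iff, h, Option.some_inj] at hj
  exact absurd (Fin.castSucc_lt_last j) (by simp [hj])

theorem mem_ahead_succ {τ : Strategy} {k : ℕ} {t : Fin (k + 1) → ℝ} {r : Fin (k + 1) → ℕ}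
    (h : t ∈ ahead τ (k + 1) r) :
    t ∈ stopNow τ k r ∨ Fin.init t ∈ ahead τ k (Fin.init r) ∧ r (Fin.last k) ≠ 1 := by
  obtain ⟨j, hj, hl⟩ := h
  induction j using Fin.lastCases with
  | last => exact Or.inl hj
  | cast j =>
    refine Or.inr ⟨⟨j, (choose_succ_eq_castSucc_iff τ t r j).1 hj, fun l hlt => ?_⟩,
      hl _ (Fin.castSucc_lt_last j)⟩
    exact hl l.castSucc (Fin.castSucc_lt_castSucc_iff.2 hlt)

theorem measurableSet_goOn (τ : Strategy) (k : ℕ) (r : Fin k → ℕ) : MeasurableSet (goOn τ k r) := by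
  have : goOn τ k r = ⋂ j, {t | τ.choose k t r = some j}ᶜ := by
    ext t
    simp [goOn, Option.eq_none_iff_forall_ne_some]
  rw [this]
  exact MeasurableSet.iInter fun j => (τ.measurable k r j).compl

theorem measurableSet_stopNow (τ : Strategy) (k : ℕ) (r : Fin (k + 1) → ℕ) :
    MeasurableSet (stopNow τ k r) :=
  τ.measurable _ _ _

theorem measurableSet_ahead (τ : Strategy) (k : ℕ) (r : Fin k → ℕ) :
    MeasurableSet (ahead τ k r) := by
  have : ahead τ k r = ⋃ j, {t | τ.choose k t r = some j} ∩ {_t | ∀ l, j < l → r l ≠ 1} := by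
    ext t
    simp [ahead]
  rw [this]
  exact MeasurableSet.iUnion fun j => (τ.measurable k r j).inter (MeasurableSet.const _)

/-- The integral over the histories of `k + 1` arrivals at the last of which the strategy stops,
with a weight depending on the time of stopping. -/
noncomputable def stopSum (τ : Strategy) (k : ℕ) (c : ℝ → ℝ≥0∞) : ℝ≥0∞ :=
  historySum (k + 1) fun t r => (stopNow τ k r).indicator (fun t => c (t (Fin.last k))) t

theorem measurable_stopNow_indicator (τ : Strategy) (k : ℕ) {c : ℝ → ℝ≥0∞} (hc : Measurable c)
    (r : Fin (k + 1) → ℕ) :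
    Measurable fun t => (stopNow τ k r).indicator (fun t => c (t (Fin.last k))) t :=
  (hc.comp (measurable_pi_apply _)).indicator (measurableSet_stopNow τ k r)

/-- The last arrival is either the chosen one or one of the `k` nonrecord ranks following a history
already ahead. -/
theorem historySum_ahead_succ_le (τ : Strategy) (k : ℕ) {c : ℝ → ℝ≥0∞} (hc : Measurable c) :
    historySum (k + 1) (fun t r => (ahead τ (k + 1) r).indicator (fun t => c (lastTime t)) t) ≤
      stopSum τ k c + historySum k fun t r => (ahead τ k r).indicator
        (fun t => ∫⁻ u in Set.Icc (lastTime t) 1, k * c u) t := by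
  have h := historySum_succ (measurableSet_ahead τ k) (c₁ := fun _ => 0) measurable_const hc
  simp only [zero_add] at h
  rw [← h, stopSum, ← historySum_add (measurable_stopNow_indicator τ k hc)]
  refine historySum_mono fun t _ r => ?_
  by_cases ht : t ∈ ahead τ (k + 1) r
  · rw [Set.indicator_of_mem ht]
    rcases mem_ahead_succ ht with h | ⟨h, h1⟩
    · rw [Set.indicator_of_mem h]
      exact le_self_add
    · rw [Set.indicator_of_mem h, if_neg h1]
      exact le_add_self
  · rw [Set.indicator_of_notMem ht]
    exact zero_le

/-- The weighted probability that the arrival at position `j`, which is a record and takes place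
at time `u`, is the best of `m + 1` items. -/
noncomputable def bestWeight (q : ℝ) (m j : ℕ) (u : ℝ) : ℝ :=
  q ^ (m + 1) * (m.choose j * (1 - u) ^ (m - j))

theorem continuous_bestWeight (q : ℝ) (m j : ℕ) : Continuous (bestWeight q m j) := by
  unfold bestWeight
  fun_prop

theorem bestWeight_nonneg {q : ℝ} (hq : 0 ≤ q) (m j : ℕ) {u : ℝ} (hu : u ≤ 1) :
    0 ≤ bestWeight q m j u := by
  have : 0 ≤ 1 - u := by linarith
  unfold bestWeight
  positivity

/-- `(j+1) C(m, j+1) = (m-j) C(m, j)`: integrating out one nonrecord arrival, with its `j + 1`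
possible ranks, lowers the index of the weight by one. -/
theorem lintegral_bestWeight_succ {q : ℝ} (hq : 0 ≤ q) {m j : ℕ} (hj : j < m) {t : ℝ} (ht : t ≤ 1) :
    ∫⁻ u in Set.Icc t 1, ((j + 1 : ℕ) : ℝ≥0∞) * ENNReal.ofReal (bestWeight q m (j + 1) u) =
      ENNReal.ofReal (bestWeight q m j t) := by
  have hcast : ∀ u : ℝ, ((j + 1 : ℕ) : ℝ≥0∞) * ENNReal.ofReal (bestWeight q m (j + 1) u) =
      ENNReal.ofReal (((j + 1 : ℕ) : ℝ) * bestWeight q m (j + 1) u) := fun u => by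
    rw [ENNReal.ofReal_mul (Nat.cast_nonneg _), ENNReal.ofReal_natCast]
  simp only [hcast]
  obtain ⟨d, rfl⟩ : ∃ d, m = j + 1 + d := ⟨m - (j + 1), by omega⟩
  have hch : ((j + 1 + d).choose (j + 1) : ℝ) * (j + 1) = (j + 1 + d).choose j * (d + 1) := by
    have := Nat.choose_succ_right_eq (j + 1 + d) j
    rw [show j + 1 + d - j = d + 1 by omega] at this
    exact_mod_cast this
  rw [lintegral_Icc_of_hasDerivAt (F := fun u => -bestWeight q (j + 1 + d) j u)
    Set.countable_empty ht (continuous_bestWeight _ _ _).neg.continuousOn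
    ((continuous_bestWeight _ _ _).const_mul _).continuousOn]
  · congr 1
    simp [bestWeight, show j + 1 + d - j = d + 1 by omega]
  · intro u _
    have h := ((((hasDerivAt_one_sub_pow_div d u).mul_const ((d : ℝ) + 1)).const_mul
      ((j + 1 + d).choose j : ℝ)).const_mul (q ^ (j + 1 + d + 1))).neg
    have hfun : (fun u => -bestWeight q (j + 1 + d) j u) = -fun u => q ^ (j + 1 + d + 1) *
        (((j + 1 + d).choose j : ℝ) * ((1 - u) ^ (d + 1) / (d + 1) * (d + 1))) := by
      funext u
      have : (d : ℝ) + 1 ≠ 0 := by positivity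
      simp only [bestWeight, show j + 1 + d - j = d + 1 by omega, Pi.neg_apply]
      field_simp
    rw [hfun]
    refine h.congr_deriv ?_
    simp only [bestWeight, show j + 1 + d - (j + 1) = d by omega]
    push_cast
    linear_combination (-(q ^ (j + 1 + d + 1) * (1 - u) ^ d)) * hch
  · intro u hu
    exact mul_nonneg (Nat.cast_nonneg _) (bestWeight_nonneg hq _ _ hu.2)

theorem historySum_ahead_le (τ : Strategy) {q : ℝ} (hq : 0 ≤ q) (m : ℕ) {k : ℕ} (hk : k ≤ m) :
    historySum (k + 1) (fun t r => (ahead τ (k + 1) r).indicator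
      (fun t => ENNReal.ofReal (bestWeight q m k (lastTime t))) t) ≤
      ∑ j ∈ range (k + 1), stopSum τ j fun u => ENNReal.ofReal (bestWeight q m j u) := by
  have hm : ∀ j, Measurable fun u => ENNReal.ofReal (bestWeight q m j u) := fun j =>
    (continuous_bestWeight q m j).measurable.ennreal_ofReal
  induction k with
  | zero =>
    refine (historySum_ahead_succ_le τ 0 (hm 0)).trans ?_
    simp [historySum]
  | succ k ih =>
    rw [sum_range_succ, add_comm (∑ j ∈ range (k + 1), _)]
    refine (historySum_ahead_succ_le τ (k + 1) (hm (k + 1))).trans ?_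
    gcongr
    refine le_trans (historySum_mono fun t ht r => ?_) (ih (by omega))
    refine Set.indicator_le_indicator ?_
    exact (lintegral_bestWeight_succ hq (by omega) (lastTime_mem ht).2).le

/-- Sorting the times preserves volume for each permutation, and distinct permutations have distinct
rank sequences. After the best item no record can occur, so a win is a history that is ahead at the
end. -/
theorem arrivalLaw_winEvent_le (τ : Strategy) (n : ℕ) :
    arrivalLaw n (winEvent τ n) ≤ ∑ r ∈ rankSeqs n, volume (ahead τ n r ∩ orderedTimes n) := by
  classical
  set B : (Fin n → ℕ) → Set (Fin n → ℝ) := fun r => ahead τ n r ∩ orderedTimes n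
  have hcube : MeasurableSet (Set.univ.pi fun _ : Fin n => Set.Icc (0 : ℝ) 1) :=
    MeasurableSet.univ_pi fun _ => measurableSet_Icc
  rw [arrivalLaw_eq_restrict, Measure.restrict_apply' hcube]
  have hsub : winEvent τ n ∩ (Set.univ.pi fun _ : Fin n => Set.Icc (0 : ℝ) 1) ⊆
      ⋃ σ : Equiv.Perm (Fin n), {ω | ω ∘ σ ∈ B (permRank σ)} := by
    rintro ω ⟨⟨k, hk, h0⟩, hω⟩
    rw [Set.mem_iUnion]
    refine ⟨Tuple.sort ω, ⟨k, hk, fun l hl h1 => ?_⟩, Tuple.monotone_sort ω,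
      fun i => hω _ (Set.mem_univ _)⟩
    have := permRank_eq_one_iff.1 h1 k hl
    rw [Fin.lt_def] at this
    change _ < (itemAt ω k : ℕ) at this
    omega
  refine (measure_mono hsub).trans ((measure_iUnion_fintype_le _ _).trans ?_)
  have hvol : ∀ (σ : Equiv.Perm (Fin n)) (S : Set (Fin n → ℝ)),
      volume {ω : Fin n → ℝ | ω ∘ σ ∈ S} = volume S := fun σ S =>
    (volume_preserving_arrowCongr' σ.symm (MeasurableEquiv.refl ℝ)
      (MeasurePreserving.id volume)).measure_preimage_equiv S
  simp only [hvol]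
  rw [← sum_image (f := fun r => volume (B r)) (g := permRank) (permRank_injective n).injOn]
  refine sum_le_sum_of_subset fun r hr => ?_
  obtain ⟨σ, -, rfl⟩ := mem_image.1 hr
  exact Fintype.mem_piFinset.2 fun k => permRank_mem_Icc σ k

theorem pow_mul_arrivalLaw_winEvent_le (τ : Strategy) {q : ℝ} (hq : 0 ≤ q) (m : ℕ) :
    ENNReal.ofReal (q ^ (m + 1)) * arrivalLaw (m + 1) (winEvent τ (m + 1)) ≤
      ∑' j, stopSum τ j fun u => ENNReal.ofReal (bestWeight q m j u) := by
  refine le_trans ?_ ((historySum_ahead_le τ hq m le_rfl).trans (ENNReal.sum_le_tsum _))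
  refine (mul_le_mul_right (arrivalLaw_winEvent_le τ (m + 1)) _).trans ?_
  simp only [historySum, mul_sum]
  refine (sum_congr rfl fun r _ => ?_).le
  have : (fun t : Fin (m + 1) → ℝ => ENNReal.ofReal (bestWeight q m m (lastTime t))) =
      fun _ => ENNReal.ofReal (q ^ (m + 1)) := by
    funext t
    simp [bestWeight]
  rw [this, lintegral_indicator_const (measurableSet_ahead τ _ r),
    Measure.restrict_apply (measurableSet_ahead τ _ r)]

theorem stopSum_tsum (τ : Strategy) (k : ℕ) {c : ℕ → ℝ → ℝ≥0∞} (hc : ∀ m, Measurable (c m)) :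
    ∑' m, stopSum τ k (c m) = stopSum τ k fun u => ∑' m, c m u := by
  unfold stopSum historySum
  rw [Summable.tsum_finsetSum fun _ _ => ENNReal.summable]
  refine sum_congr rfl fun r _ => ?_
  rw [← lintegral_tsum fun m => (measurable_stopNow_indicator τ k (hc m) r).aemeasurable]
  refine lintegral_congr fun t => ?_
  by_cases ht : t ∈ stopNow τ k r
  · simp only [Set.indicator_of_mem ht]
  · simp only [Set.indicator_of_notMem ht, tsum_zero]

/-- The negative binomial series; the terms with `m < j` vanish. -/
theorem tsum_bestWeight {q : ℝ} (hq0 : 0 ≤ q) (hq1 : q < 1) (j : ℕ) {u : ℝ} (hu : u ∈ Set.Icc 0 1) :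
    ∑' m, ENNReal.ofReal (bestWeight q m j u) =
      ENNReal.ofReal ((q / (1 - q * (1 - u))) ^ (j + 1)) := by
  have hu1 : 0 ≤ 1 - u := by linarith [hu.2]
  have hz0 : 0 ≤ q * (1 - u) := mul_nonneg hq0 hu1
  have hz1 : q * (1 - u) < 1 := by nlinarith [hu.1]
  have h := (hasSum_choose_mul_geometric_of_norm_lt_one (𝕜 := ℝ) j
    (by rwa [Real.norm_of_nonneg hz0])).mul_left (q ^ (j + 1))
  have h' : HasSum (fun m => bestWeight q m j u) ((q / (1 - q * (1 - u))) ^ (j + 1)) := by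
    rw [← hasSum_nat_add_iff' j]
    have hzero : ∑ m ∈ range j, bestWeight q m j u = 0 :=
      sum_eq_zero fun m hm => by simp [bestWeight, Nat.choose_eq_zero_of_lt (mem_range.1 hm)]
    rw [hzero, sub_zero]
    convert! h using 1
    · funext l
      simp only [bestWeight, Nat.add_sub_cancel, mul_pow]
      ring
    · rw [div_pow]; ring
  rw [← ENNReal.ofReal_tsum_of_nonneg (fun m => bestWeight_nonneg hq0 m j hu.2) h'.summable,
    h'.tsum_eq]

theorem tsum_pow_mul_arrivalLaw_le (τ : Strategy) {q : ℝ} (hq0 : 0 ≤ q) (hq1 : q < 1) :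
    ∑' m, ENNReal.ofReal (q ^ (m + 1)) * arrivalLaw (m + 1) (winEvent τ (m + 1)) ≤
      ∑' j, stopSum τ j fun u => ENNReal.ofReal ((q / (1 - q * (1 - u))) ^ (j + 1)) := by
  refine (ENNReal.tsum_le_tsum fun m => pow_mul_arrivalLaw_winEvent_le τ hq0 m).trans ?_
  rw [ENNReal.tsum_comm]
  refine ENNReal.tsum_le_tsum fun j => ?_
  rw [stopSum_tsum τ j fun m => (continuous_bestWeight q m j).measurable.ennreal_ofReal]
  refine historySum_mono fun t ht r => Set.indicator_le_indicator ?_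
  exact (tsum_bestWeight hq0 hq1 j (ht.2 (Fin.last j))).le

/-! ### Optimal stopping under geometric weights -/

/-- The optimal continuation value when a record occurring now is the best of all
with probability `s`. -/
noncomputable def contValue (s : ℝ) : ℝ :=
  Real.negMulLog (max s (Real.exp (-1)))

theorem continuous_contValue : Continuous contValue :=
  Real.continuous_negMulLog.comp (continuous_id.max continuous_const)

theorem contValue_of_le {s : ℝ} (h : s ≤ Real.exp (-1)) : contValue s = Real.exp (-1) := by
  simp [contValue, max_eq_right h, Real.negMulLog]

theorem contValue_of_ge {s : ℝ} (h : Real.exp (-1) ≤ s) : contValue s = -s * Real.log s := by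
  simp [contValue, max_eq_left h, Real.negMulLog]

theorem contValue_one : contValue 1 = 0 := by
  rw [contValue_of_ge (Real.exp_le_one_iff.2 (by norm_num))]
  simp

theorem contValue_nonneg {s : ℝ} (h : s ≤ 1) : 0 ≤ contValue s :=
  Real.negMulLog_nonneg (le_max_of_le_right (Real.exp_pos _).le)
    (max_le h (Real.exp_le_one_iff.2 (by norm_num)))

theorem hasDerivAt_contValue {s : ℝ} (hs : 0 < s) (hne : s ≠ Real.exp (-1)) :
    HasDerivAt contValue ((contValue s - max s (contValue s)) / s) s := by
  rcases hne.lt_or_gt with h | h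
  · rw [contValue_of_le h.le, max_eq_right h.le, sub_self, zero_div]
    refine (hasDerivAt_const s (Real.exp (-1))).congr_of_eventuallyEq ?_
    filter_upwards [Iio_mem_nhds h] with u hu using contValue_of_le (le_of_lt hu)
  · have hlog : -1 < Real.log s := (Real.lt_log_iff_exp_lt hs).2 h
    rw [contValue_of_ge h.le, max_eq_left (by nlinarith)]
    have h1 := (Real.hasDerivAt_negMulLog hs.ne').congr_of_eventuallyEq
      (f₁ := contValue) (by
        filter_upwards [Ioi_mem_nhds h] with u hu
        exact contValue_of_ge (le_of_lt hu))
    refine h1.congr_deriv ?_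
    field_simp

/-- The density of the optimal continuation value at the histories of `k` arrivals, the last one
at time `u`, when the number of items has the weights `q ^ n`. -/
noncomputable def contDensity (q : ℝ) (k : ℕ) (u : ℝ) : ℝ :=
  q ^ k * (contValue (1 - q * (1 - u)) / (1 - q * (1 - u)) ^ (k + 1))

/-- The Bellman equation. A history of `k` arrivals ending at `u` has total weight `q^k / s^(k+1)`,
which `contDensity` multiplies by the continuation value. The next arrival is a record in one way,
worth `max s (contValue s)`, and a nonrecord in `k` ways, worth `contValue s`. The boundary term
vanishes as `contValue 1 = 0`. -/
theorem lintegral_contDensity {q : ℝ} (hq0 : 0 < q) (hq1 : q < 1) (k : ℕ) {t : ℝ}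
    (ht : t ∈ Set.Icc 0 1) :
    ∫⁻ u in Set.Icc t 1, (ENNReal.ofReal (q ^ (k + 1) / (1 - q * (1 - u)) ^ (k + 2) *
        max (1 - q * (1 - u)) (contValue (1 - q * (1 - u)))) +
      k * ENNReal.ofReal (contDensity q (k + 1) u)) = ENNReal.ofReal (contDensity q k t) := by
  have hpos : ∀ u ∈ Set.Icc t 1, 0 < 1 - q * (1 - u) ∧ 1 - q * (1 - u) ≤ 1 := fun u hu =>
    ⟨by nlinarith [hu.1, ht.1], by nlinarith [hu.2]⟩
  set s : ℝ → ℝ := fun u => 1 - q * (1 - u) with hs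
  have hsc : Continuous s := by fun_prop
  have hcv : Continuous fun u => contValue (s u) := continuous_contValue.comp hsc
  have hd0 : ∀ u ∈ Set.Icc t 1, 0 ≤ contDensity q (k + 1) u := fun u hu => by
    have := contValue_nonneg (hpos u hu).2
    have := (hpos u hu).1
    unfold contDensity
    positivity
  have hm0 : ∀ u ∈ Set.Icc t 1, 0 ≤ q ^ (k + 1) / s u ^ (k + 2) * max (s u) (contValue (s u)) :=
    fun u hu => by
      have := contValue_nonneg (hpos u hu).2
      have := (hpos u hu).1
      positivity
  rw [setLIntegral_congr_fun (g := fun u => ENNReal.ofReal (q ^ (k + 1) / s u ^ (k + 2) *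
      max (s u) (contValue (s u)) + k * contDensity q (k + 1) u)) measurableSet_Icc fun u hu => ?_,
    lintegral_Icc_of_hasDerivAt (F := fun u => -contDensity q k u)
      (s := {u | s u = Real.exp (-1)}) ?_ ht.2 ?_ ?_ ?_ ?_]
  · simp [contDensity, contValue_one]
  -- The gluing point of the two branches of `contValue` is attained for at most one `u`.
  · refine Set.Subsingleton.countable fun a ha b hb => ?_
    have : s a = s b := Eq.trans ha (Eq.symm hb)
    have : q * a = q * b := by simp only [hs] at this; linarith
    exact mul_left_cancel₀ hq0.ne' this
  · refine (continuousOn_const.mul (hcv.continuousOn.div (hsc.pow _).continuousOn fun u hu => ?_)).neg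
    exact (pow_pos (hpos u hu).1 _).ne'
  · refine ContinuousOn.add ((continuousOn_const.div (hsc.pow _).continuousOn fun u hu => ?_).mul
      (hsc.max hcv).continuousOn) (continuousOn_const.mul
      (continuousOn_const.mul (hcv.continuousOn.div (hsc.pow _).continuousOn fun u hu => ?_)))
    · exact (pow_pos (hpos u hu).1 _).ne'
    · exact (pow_pos (hpos u hu).1 _).ne'
  · rintro u ⟨hu, hne⟩
    have hsu := (hpos u (Set.Ioo_subset_Icc_self hu)).1
    have hs' : HasDerivAt s q u := by
      have := (((hasDerivAt_id u).const_sub 1).const_mul q).const_sub 1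
      exact this.congr_deriv (by simp)
    have h := (((HasDerivAt.comp u (hasDerivAt_contValue hsu hne) hs').div (hs'.pow (k + 1))
      (pow_pos hsu _).ne').const_mul (q ^ k)).neg
    refine h.congr_deriv ?_
    change _ = q ^ (k + 1) / s u ^ (k + 2) * max (s u) (contValue (s u)) +
      k * (q ^ (k + 1) * (contValue (s u) / s u ^ (k + 1 + 1)))
    change 0 < s u at hsu
    have hp : (s ^ (k + 1)) u = s u ^ (k + 1) := rfl
    have hc : (contValue ∘ s) u = contValue (s u) := rfl
    simp only [hp, hc, Nat.add_sub_cancel]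
    generalize contValue (s u) = g
    generalize max (s u) g = M
    generalize s u = y at hsu
    push_cast
    field_simp
    ring
  · intro u hu
    have := hd0 u hu
    have := hm0 u hu
    positivity
  · simp only
    rw [ENNReal.ofReal_add (hm0 u hu) (mul_nonneg (Nat.cast_nonneg _) (hd0 u hu)),
      ENNReal.ofReal_mul (Nat.cast_nonneg _), ENNReal.ofReal_natCast]

/-- The integral of the continuation value over the histories after which the strategy
has not stopped. -/
noncomputable def goOnSum (τ : Strategy) (q : ℝ) (k : ℕ) : ℝ≥0∞ :=
  historySum k fun t r => (goOn τ k r).indicator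
    (fun t => ENNReal.ofReal (contDensity q k (lastTime t))) t

theorem measurable_contDensity (q : ℝ) (k : ℕ) : Measurable (contDensity q k) := by
  have := continuous_contValue.measurable
  unfold contDensity
  fun_prop

/-- At a record, stopping and continuing are each worth at most the maximum in the Bellman equation;
at a nonrecord the strategy can only continue. -/
theorem stopSum_add_goOnSum_le (τ : Strategy) {q : ℝ} (hq0 : 0 < q) (hq1 : q < 1) (k : ℕ) :
    stopSum τ k (fun u => ENNReal.ofReal ((q / (1 - q * (1 - u))) ^ (k + 1))) +
      goOnSum τ q (k + 1) ≤ goOnSum τ q k := by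
  set c₁ : ℝ → ℝ≥0∞ := fun u => ENNReal.ofReal (q ^ (k + 1) / (1 - q * (1 - u)) ^ (k + 2) *
        max (1 - q * (1 - u)) (contValue (1 - q * (1 - u))))
  have hm₁ : Measurable c₁ := by
    have := continuous_contValue.measurable
    fun_prop
  have hm₀ : Measurable fun u => ENNReal.ofReal (contDensity q (k + 1) u) :=
    (measurable_contDensity q (k + 1)).ennreal_ofReal
  have h := historySum_succ (measurableSet_goOn τ k) hm₁ hm₀
  have hgo : goOnSum τ q k = historySum k fun t r => (goOn τ k r).indicator
      (fun t => ∫⁻ u in Set.Icc (lastTime t) 1,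
        (c₁ u + k * ENNReal.ofReal (contDensity q (k + 1) u))) t := by
    refine le_antisymm (historySum_mono fun t ht r => Set.indicator_le_indicator ?_)
      (historySum_mono fun t ht r => Set.indicator_le_indicator ?_)
    · exact (lintegral_contDensity hq0 hq1 k (lastTime_mem ht)).ge
    · exact (lintegral_contDensity hq0 hq1 k (lastTime_mem ht)).le
  rw [hgo, ← h, goOnSum, stopSum, ← historySum_add (measurable_stopNow_indicator τ k
    (c := fun u => ENNReal.ofReal ((q / (1 - q * (1 - u))) ^ (k + 1))) (by fun_prop))]
  refine historySum_mono fun t ht r => ?_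
  have hu := ht.2 (Fin.last k)
  have hs0 : 0 < 1 - q * (1 - t (Fin.last k)) := by nlinarith [hu.1]
  by_cases hmem : t ∈ stopNow τ k r
  · have hgo : t ∉ goOn τ (k + 1) r := fun hn => by
      have hn' : τ.choose (k + 1) t r = none := hn
      have hs' : τ.choose (k + 1) t r = some (Fin.last k) := hmem
      simp [hn'] at hs'
    rw [Set.indicator_of_mem hmem, Set.indicator_of_notMem hgo, add_zero,
      Set.indicator_of_mem (init_mem_goOn_of_mem_stopNow hmem), if_pos (τ.record _ _ _ _ hmem)]
    refine ENNReal.ofReal_le_ofReal ?_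
    calc (q / (1 - q * (1 - t (Fin.last k)))) ^ (k + 1)
        = q ^ (k + 1) / (1 - q * (1 - t (Fin.last k))) ^ (k + 2) *
          (1 - q * (1 - t (Fin.last k))) := by
          rw [div_pow]
          field_simp
          ring
      _ ≤ _ := by
          gcongr
          exact le_max_left _ _
  · rw [Set.indicator_of_notMem hmem, zero_add]
    by_cases hgo : t ∈ goOn τ (k + 1) r
    · rw [Set.indicator_of_mem hgo, Set.indicator_of_mem (init_mem_goOn_of_mem_goOn hgo)]
      split_ifs
      · refine ENNReal.ofReal_le_ofReal ?_
        change q ^ (k + 1) * (contValue (1 - q * (1 - t (Fin.last k))) /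
          (1 - q * (1 - t (Fin.last k))) ^ (k + 1 + 1)) ≤ _
        rw [mul_div_assoc', mul_div_right_comm]
        gcongr
        exact le_max_right _ _
      · exact le_rfl
    · rw [Set.indicator_of_notMem hgo]
      exact zero_le

/-- The empty history is a single point with `lastTime` equal to `0`, hence `s = 1 - q`. -/
theorem goOnSum_zero_le (τ : Strategy) (q : ℝ) :
    goOnSum τ q 0 ≤ ENNReal.ofReal (contValue (1 - q) / (1 - q)) := by
  have hvol : (volume : Measure (Fin 0 → ℝ)) (orderedTimes 0) ≤ 1 := by
    rw [volume_pi, Measure.pi_of_empty]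
    exact prob_le_one
  calc goOnSum τ q 0
      ≤ ∑ r ∈ rankSeqs 0, ∫⁻ _ in orderedTimes 0, ENNReal.ofReal (contValue (1 - q) / (1 - q)) := by
        refine historySum_mono (G := fun _ _ => ENNReal.ofReal (contValue (1 - q) / (1 - q)))
          fun t _ r => (Set.indicator_le_self _ _ _).trans ?_
        simp [contDensity, lastTime]
    _ ≤ _ := by
        simp only [lintegral_const, Measure.restrict_apply_univ, sum_const, rankSeqs,
          Fintype.card_piFinset, univ_eq_empty, prod_empty, one_smul]
        exact mul_le_of_le_one_right' hvol

theorem tsum_stopSum_le (τ : Strategy) {q : ℝ} (hq0 : 0 < q) (hq1 : q < 1) :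
    ∑' j, stopSum τ j (fun u => ENNReal.ofReal ((q / (1 - q * (1 - u))) ^ (j + 1))) ≤
      ENNReal.ofReal (contValue (1 - q) / (1 - q)) := by
  have h : ∀ k, ∑ j ∈ range k,
      stopSum τ j (fun u => ENNReal.ofReal ((q / (1 - q * (1 - u))) ^ (j + 1))) +
        goOnSum τ q k ≤ goOnSum τ q 0 := by
    intro k
    induction k with
    | zero => simp
    | succ k ih =>
      rw [sum_range_succ, add_assoc]
      exact (add_le_add_right (stopSum_add_goOnSum_le τ hq0 hq1 k) _).trans ih
  exact ENNReal.tsum_le_of_sum_range_le fun k =>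
    (le_self_add.trans (h k)).trans (goOnSum_zero_le τ q)

/-- When the number `n` of items has the weights `q ^ n`, no strategy does better than the optimal
continuation value at time `0`. -/
theorem tsum_pow_mul_W_le (τ : Strategy) {q : ℝ} (hq0 : 0 < q) (hq1 : q < 1) :
    Summable (fun m => q ^ (m + 1) * W τ (m + 1)) ∧
      ∑' m, q ^ (m + 1) * W τ (m + 1) ≤ contValue (1 - q) / (1 - q) := by
  have hnn : ∀ m, 0 ≤ q ^ (m + 1) * W τ (m + 1) := fun m =>
    mul_nonneg (by positivity) measureReal_nonneg
  have hsum : Summable (fun m => q ^ (m + 1) * W τ (m + 1)) := by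
    refine Summable.of_nonneg_of_le hnn (fun m => ?_)
      ((summable_nat_add_iff 1).2 (summable_geometric_of_lt_one hq0.le hq1))
    exact mul_le_of_le_one_right (by positivity) measureReal_le_one
  refine ⟨hsum, ?_⟩
  have h0 : 0 ≤ contValue (1 - q) / (1 - q) :=
    div_nonneg (contValue_nonneg (by linarith)) (by linarith)
  rw [← ENNReal.ofReal_le_ofReal_iff h0, ENNReal.ofReal_tsum_of_nonneg hnn hsum]
  refine le_trans (le_of_eq ?_) ((tsum_pow_mul_arrivalLaw_le τ hq0.le hq1).trans
    (tsum_stopSum_le τ hq0 hq1))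
  refine tsum_congr fun m => ?_
  rw [ENNReal.ofReal_mul (by positivity), W, ofReal_measureReal]

theorem undominated_xStrategy {x : ℝ} (hx0 : 0 ≤ x) (hx : x < Real.exp (-1)) :
    Undominated (xStrategy x) := by
  have he : Real.exp (-1) < 1 := by simp
  have hx1 : 0 < 1 - x := by linarith
  -- This choice makes `s = 1/e` exactly at `u = x`, the time from which the optimal rule accepts
  -- records.
  set q := (1 - Real.exp (-1)) / (1 - x)
  have hq0 : 0 < q := div_pos (by linarith) hx1
  have hq1 : q < 1 := (div_lt_one hx1).2 (by linarith)
  have hqx : q * (1 - x) = 1 - Real.exp (-1) := div_mul_cancel₀ _ hx1.ne'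
  have hval : HasSum (fun m => q ^ (m + 1) * W (xStrategy x) (m + 1))
      (contValue (1 - q) / (1 - q)) := by
    have h := hasSum_winPoly hx0 (hx.trans he).le hq0 hq1
    simp only [W_xStrategy _ hx0 (hx.trans he).le]
    convert! h using 1
    -- `1 - q ≤ 1/e` because `x ≥ 0`; both sides become `(1/e) / (1 - q)`.
    rw [hqx, contValue_of_le (by nlinarith)]
    have : 1 - q ≠ 0 := by linarith
    simp only [sub_sub_cancel, Real.log_exp]
    field_simp
    linarith
  rintro ⟨τ, hle, n, hn, hlt⟩
  obtain ⟨hs, hb⟩ := tsum_pow_mul_W_le τ hq0 hq1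
  obtain ⟨m, rfl⟩ : ∃ m, n = m + 1 := ⟨n - 1, (Nat.sub_add_cancel hn).symm⟩
  have := Summable.tsum_lt_tsum (i := m)
    (fun m => mul_le_mul_of_nonneg_left (hle (m + 1) (Nat.succ_le_succ m.zero_le))
      (pow_nonneg hq0.le (m + 1)))
    (mul_lt_mul_of_pos_left hlt (pow_pos hq0 (m + 1))) hval.summable hs
  rw [hval.tsum_eq] at this
  exact absurd hb (not_le.2 this)

end BestChoice

/-! ### The three claims -/

theorem proposition2 :
    (∀ x y : ℝ, Real.exp (-1) ≤ x → x < y → y ≤ 1 →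
      BestChoice.Dominates (BestChoice.xStrategy x) (BestChoice.xStrategy y)) ∧
    (∀ n : ℕ, 1 ≤ n → ∃ xn ∈ Set.Icc (0 : ℝ) 1,
      (∀ z ∈ Set.Icc (0 : ℝ) 1, z ≠ xn →
        BestChoice.W (BestChoice.xStrategy z) n < BestChoice.W (BestChoice.xStrategy xn) n) ∧
      ∀ x y : ℝ, 0 ≤ x → x < y → y ≤ xn →
        BestChoice.DominatesOn {m : ℕ | n ≤ m}
          (BestChoice.xStrategy y) (BestChoice.xStrategy x)) ∧
    (∀ x : ℝ, 0 ≤ x → x < Real.exp (-1) →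
      BestChoice.Undominated (BestChoice.xStrategy x)) := by
  refine ⟨fun x y hx hxy hy => ?_, fun n hn => ?_, fun x => BestChoice.undominated_xStrategy⟩
  · have hx0 : 0 ≤ x := (Real.exp_pos _).le.trans hx
    have hlt : ∀ n, 1 ≤ n →
        BestChoice.W (BestChoice.xStrategy y) n < BestChoice.W (BestChoice.xStrategy x) n := by
      intro n hn
      obtain ⟨m, rfl⟩ : ∃ m, n = m + 1 := ⟨n - 1, (Nat.sub_add_cancel hn).symm⟩
      rw [BestChoice.W_xStrategy m hx0 (hxy.le.trans hy),
        BestChoice.W_xStrategy m (hx0.trans hxy.le) hy]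
      exact BestChoice.winPoly_strictAntiOn
        (fun z hz => BestChoice.winPolyDeriv_neg hz.1 hz.2 m) ⟨hx, hxy.le.trans hy⟩
        ⟨hx.trans hxy.le, hy⟩ hxy
    exact ⟨fun n hn => (hlt n hn).le, 1, Nat.le_refl 1, hlt 1 le_rfl⟩
  · obtain ⟨m, rfl⟩ : ∃ m, n = m + 1 := ⟨n - 1, (Nat.sub_add_cancel hn).symm⟩
    obtain ⟨c, hc, hpos, hneg⟩ := BestChoice.exists_winPolyDeriv_sign m
    refine ⟨c, hc, fun z hz hzc => ?_, fun x y hx hxy hy => ?_⟩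
    · rw [BestChoice.W_xStrategy m hz.1 hz.2, BestChoice.W_xStrategy m hc.1 hc.2]
      rcases hzc.lt_or_gt with h | h
      · exact BestChoice.winPoly_strictMonoOn hpos ⟨hz.1, h.le⟩ ⟨hc.1, le_rfl⟩ h
      · exact BestChoice.winPoly_strictAntiOn hneg ⟨le_rfl, hc.2⟩ ⟨h.le, hz.2⟩ h
    · have hlt : ∀ n, m + 1 ≤ n →
          BestChoice.W (BestChoice.xStrategy x) n < BestChoice.W (BestChoice.xStrategy y) n := by
        intro n hn
        obtain ⟨l, rfl⟩ : ∃ l, n = l + 1 := ⟨n - 1, by omega⟩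
        have hy1 := hy.trans hc.2
        rw [BestChoice.W_xStrategy l hx (hxy.le.trans hy1),
          BestChoice.W_xStrategy l (hx.trans hxy.le) hy1]
        -- The derivative grows with the number of items, so it stays positive on `[0, c)` for every
        -- larger number.
        refine BestChoice.winPoly_strictMonoOn (fun z hz => (hpos z hz).trans_le ?_)
          ⟨hx, hxy.le.trans hy⟩ ⟨hx.trans hxy.le, hy⟩ hxy
        exact BestChoice.winPolyDeriv_mono (by omega) (hz.2.le.trans hc.2)
      exact ⟨fun n hn => (hlt n hn).le, m + 1, Nat.le_refl _, hlt _ le_rfl⟩
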